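/- Let $M>0$, $\ell_0>0$ and $a\in\mathbb R$, and put $$\rho_G(R)=\frac{M}{(4\pi\ell_0^2)^{3/2}}\,e^{-R^2/4\ell_0^2},\quad M(R)=4\pi\int_0^R x^2\rho_G(x)\,dx,\quad \Sigma=R^2+a^2\cos^2\vartheta,\quad \Delta_K(R)=R^2-2RM(R)+a^2 .$$ Assume that at least one horizon exists: $\Delta_K(R_h)=0$ for some $R_h>0$. Let $U$ be any non-empty open set of coordinates $(R,\vartheta)$ with $R>0$, $0<\vartheta<\pi$. For functions $\Delta(R)>0$, $F(R,\vartheta)>0$, $\chi(R,\vartheta)>0$, $\omega(R,\vartheta)$, $\mu(R,\vartheta)$ of class $C^2$ on $U$ consider, with $e^\beta=\sqrt\Delta\,F$, the metric $$ds^2=e^{\beta}\Big(\chi-\frac{\omega^2}{\chi}\Big)dt^2+\frac{2\omega e^\beta}{\chi}\,dt\,d\varphi-\frac{e^{2\mu}}{\Delta}\,dR^2-e^{2\mu}\,d\vartheta^2-\frac{e^\beta}{\chi}\,d\varphi^2 ,$$ and an anisotropic fluid with density $\rho$, pressures $p_R,p_\vartheta$, four-velocity $u=u^t(\partial_t+\Omega\,\partial_\varphi)$,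 $\Omega=\Omega(R,\vartheta)$, $\chi^2>(\omega-\Omega)^2$, and energy-momentum tensor $T_{\mu\nu}=(\rho+p_\vartheta)u_\mu u_\nu-p_\vartheta g_{\mu\nu}+(p_R-p_\vartheta)\ell_\mu\ell_\nu$, where $\ell=e^{-\mu}\sqrt\Delta\,\partial_R$. The reduced field equations are the following system, the signs of the right-hand sides being part of the statement: $$(\sqrt\Delta(\sqrt\Delta F)_{,R})_{,R}+F_{,\vartheta\vartheta}=-8\pi Fe^{2\mu}(p_R+p_\vartheta),\tag{EFE1}$$ $$(\Delta F(\ln\chi)_{,R})_{,R}+(F(\ln\chi)_{,\vartheta})_{,\vartheta}-\tfrac{F}{\chi^2}\big[\Delta\,\omega_{,R}^2+\omega_{,\vartheta}^2\big]=-8\pi\,\tfrac{\chi^2+(\omega-\Omega)^2}{\chi^2-(\omega-\Omega)^2}\,Fe^{2\mu}(\rho+p_\vartheta),\tag{EFE2}$$ $$\Big(\tfrac{\Delta F}{\chi^2}\omega_{,R}\Big)_{,R}+\Big(\tfrac{F}{\chi^2}\omega_{,\vartheta}\Big)_{,\vartheta}=-16\pi\,\tfrac{\omega-\Omega}{\chi^2-(\omega-\Omega)^2}\,Fe^{2\mu}(\rho+p_\vartheta),\tag{EFE3}$$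 $$(\ln F)_{,R\vartheta}-\big[\beta_{,R}\,\mu_{,\vartheta}+(\ln F)_{,\vartheta}\,\mu_{,R}\big]+\tfrac12\beta_{,R}(\ln F)_{,\vartheta}+\tfrac{\chi_{,R}\chi_{,\vartheta}-\omega_{,R}\omega_{,\vartheta}}{2\chi^2}=0,\tag{EFE4}$$ $$(\sqrt\Delta(\sqrt\Delta F)_{,R})_{,R}-F_{,\vartheta\vartheta}+2F\big[(\ln F)_{,\vartheta}\big(\tfrac14(\ln F)_{,\vartheta}+\mu_{,\vartheta}\big)-\tfrac14(\ln\chi)_{,\vartheta}^2\big]-2\Delta F\big[\beta_{,R}\big(\tfrac14\beta_{,R}+\mu_{,R}\big)-\tfrac14(\ln\chi)_{,R}^2\big]-\tfrac{F}{2\chi^2}\big[\Delta\,\omega_{,R}^2-\omega_{,\vartheta}^2\big]=8\pi Fe^{2\mu}(p_R-p_\vartheta).\tag{EFE5}$$ Then there are no such functions $\Delta,F,\chi,\omega,\mu$ and no such fluid on $U$ for which (EFE1)–(EFE5) hold on $U$ with $$p_R=-\rho,\qquad \rho=\frac{R^4}{\Sigma^2}\,\rho_G(R)$$ and for which the metric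 is, on $U$, the "Kerrr" metric $$ds^2=\Big(1-\frac{2RM(R)}{\Sigma}\Big)dt^2+\frac{4aRM(R)}{\Sigma}\sin^2\vartheta\,dt\,d\varphi-\frac{\Sigma}{\Delta_K}dR^2-\Sigma\,d\vartheta^2-\frac{\sin^2\vartheta}{\Sigma}\big[(R^2+a^2)^2-a^2\sin^2\vartheta\,\Delta_K\big]d\varphi^2 .$$ -/

import Mathlib

open Real Set

noncomputable section

/-- `∂h/∂R` for a function `h (R, ϑ)` written in curried form. -/
def dR (h : ℝ → ℝ → ℝ) : ℝ → ℝ → ℝ := fun R θ => deriv (fun r => h r θ) R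

/-- `∂h/∂ϑ` for a function `h (R, ϑ)` written in curried form. -/
def dTheta (h : ℝ → ℝ → ℝ) : ℝ → ℝ → ℝ := fun R θ => deriv (fun t => h R t) θ

/-- The five functions that determine a stationary axisymmetric metric with a horizon
`Δ(R) = 0`: `F`, `Δ`, `χ`, `ω` and `μ = μ_ϑ`. -/
structure KerrLike where
  F : ℝ → ℝ → ℝ
  Δ : ℝ → ℝ
  χ : ℝ → ℝ → ℝ
  ω : ℝ → ℝ → ℝ
  μ : ℝ → ℝ → ℝ

/-- An anisotropic fluid: density `ρ`, radial and tangential pressures `pR`, `pθ`, and the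
angular velocity `Ω = u^φ / u^t` of the four-velocity `u = u^t (∂_t + Ω ∂_φ)`. The
energy-momentum tensor is
`T_{μν} = (ρ + p_ϑ) u_μ u_ν - p_ϑ g_{μν} + (p_R - p_ϑ) ℓ_μ ℓ_ν`, where `ℓ` is the unit
space-like vector `e^{-μ_ϑ} √Δ ∂_R`; with `p_R = -ρ` this is
`T^μ_ν = (ρ + p_ϑ)(u^μ u_ν - ℓ^μ ℓ_ν) - p_ϑ δ^μ_ν`. -/
structure Fluid where
  ρ : ℝ → ℝ → ℝ
  pR : ℝ → ℝ → ℝ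
  pθ : ℝ → ℝ → ℝ
  Ω : ℝ → ℝ → ℝ

namespace KerrLike

/-- The line element, as a quadratic form in
`v = (dt, dR, dϑ, dφ)`, with `e^β = √Δ F`:
`e^β (χ - ω²/χ) dt² + 2 (ω e^β/χ) dt dφ - (e^{2μ}/Δ) dR² - e^{2μ} dϑ² - (e^β/χ) dφ²`. -/
def lineElement (g : KerrLike) (R θ : ℝ) (v : Fin 4 → ℝ) : ℝ :=
  √(g.Δ R) * g.F R θ * (g.χ R θ - g.ω R θ ^ 2 / g.χ R θ) * v 0 ^ 2
    + 2 * (g.ω R θ * (√(g.Δ R) * g.F R θ) / g.χ R θ) * v 0 * v 3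
    - exp (2 * g.μ R θ) / g.Δ R * v 1 ^ 2
    - exp (2 * g.μ R θ) * v 2 ^ 2
    - √(g.Δ R) * g.F R θ / g.χ R θ * v 3 ^ 2

/-- The five functions define a `C²` metric on the coordinate region `U`: they are of class
`C²` there, and `Δ`, `F` and `χ` are positive (so that `√Δ`, `e^β = √Δ F` and
`χ = e^{ν - ψ}` have their meaning). -/
structure IsRegularOn (g : KerrLike) (U : Set (ℝ × ℝ)) : Prop where
  pos_Δ : ∀ x ∈ U, 0 < g.Δ x.1
  pos_F : ∀ x ∈ U, 0 < g.F x.1 x.2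
  pos_χ : ∀ x ∈ U, 0 < g.χ x.1 x.2
  smooth_Δ : ContDiffOn ℝ 2 g.Δ (Prod.fst '' U)
  smooth_F : ContDiffOn ℝ 2 (fun x : ℝ × ℝ => g.F x.1 x.2) U
  smooth_χ : ContDiffOn ℝ 2 (fun x : ℝ × ℝ => g.χ x.1 x.2) U
  smooth_ω : ContDiffOn ℝ 2 (fun x : ℝ × ℝ => g.ω x.1 x.2) U
  smooth_μ : ContDiffOn ℝ 2 (fun x : ℝ × ℝ => g.μ x.1 x.2) U

/-- The fluid four-velocity is time-like, i.e. `χ² - (ω - Ω)² > 0`, so that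
`u^t = e^{-β/2} √(χ / (χ² - (ω - Ω)²))` is well defined. -/
def TimelikeFlowOn (g : KerrLike) (s : Fluid) (U : Set (ℝ × ℝ)) : Prop :=
  ∀ x ∈ U, 0 < g.χ x.1 x.2 ^ 2 - (g.ω x.1 x.2 - s.Ω x.1 x.2) ^ 2

/-- `√Δ F = e^β`. -/
def sF (g : KerrLike) : ℝ → ℝ → ℝ := fun R θ => √(g.Δ R) * g.F R θ

/-- `ln χ`. -/
def lnχ (g : KerrLike) : ℝ → ℝ → ℝ := fun R θ => log (g.χ R θ)

/-- `ln F`. -/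
def lnF (g : KerrLike) : ℝ → ℝ → ℝ := fun R θ => log (g.F R θ)

/-- `ln (√Δ F)`. -/
def lnsF (g : KerrLike) : ℝ → ℝ → ℝ := fun R θ => log (g.sF R θ)

/-- `f = (χ² + (ω - Ω)²) / (χ² - (ω - Ω)²)`. -/
def f (g : KerrLike) (s : Fluid) (R θ : ℝ) : ℝ :=
  (g.χ R θ ^ 2 + (g.ω R θ - s.Ω R θ) ^ 2) / (g.χ R θ ^ 2 - (g.ω R θ - s.Ω R θ) ^ 2)

/-- `g = (ω - Ω) / (χ² - (ω - Ω)²)`. -/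
def gg (g : KerrLike) (s : Fluid) (R θ : ℝ) : ℝ :=
  (g.ω R θ - s.Ω R θ) / (g.χ R θ ^ 2 - (g.ω R θ - s.Ω R θ) ^ 2)

/-- `(√Δ (√Δ F)_{,R})_{,R} + F_{,ϑϑ} = -8π F e^{2μ} (p_R + p_ϑ)`. -/
def EFE1 (g : KerrLike) (s : Fluid) (R θ : ℝ) : Prop :=
  dR (fun r t => √(g.Δ r) * dR g.sF r t) R θ + dTheta (dTheta g.F) R θ
    = -8 * π * g.F R θ * exp (2 * g.μ R θ) * (s.pR R θ + s.pθ R θ)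

/-- `(Δ F (ln χ)_{,R})_{,R} + (F (ln χ)_{,ϑ})_{,ϑ} - (F/χ²) [Δ (ω_{,R})² + (ω_{,ϑ})²]
= -8π f F e^{2μ} (ρ + p_ϑ)`. -/
def EFE2 (g : KerrLike) (s : Fluid) (R θ : ℝ) : Prop :=
  dR (fun r t => g.Δ r * g.F r t * dR g.lnχ r t) R θ
    + dTheta (fun r t => g.F r t * dTheta g.lnχ r t) R θ
    - g.F R θ / g.χ R θ ^ 2 * (g.Δ R * dR g.ω R θ ^ 2 + dTheta g.ω R θ ^ 2)
    = -8 * π * g.f s R θ * g.F R θ * exp (2 * g.μ R θ) * (s.ρ R θ + s.pθ R θ)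

/-- `((Δ F/χ²) ω_{,R})_{,R} + ((F/χ²) ω_{,ϑ})_{,ϑ} = -16π g F e^{2μ} (ρ + p_ϑ)`. -/
def EFE3 (g : KerrLike) (s : Fluid) (R θ : ℝ) : Prop :=
  dR (fun r t => g.Δ r * g.F r t / g.χ r t ^ 2 * dR g.ω r t) R θ
    + dTheta (fun r t => g.F r t / g.χ r t ^ 2 * dTheta g.ω r t) R θ
    = -16 * π * g.gg s R θ * g.F R θ * exp (2 * g.μ R θ) * (s.ρ R θ + s.pθ R θ)

/-- `(ln F)_{,Rϑ} - [(ln √Δ F)_{,R} μ_{,ϑ} + (ln F)_{,ϑ} μ_{,R}]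
+ ½ (ln √Δ F)_{,R} (ln F)_{,ϑ} + (χ_{,R} χ_{,ϑ} - ω_{,R} ω_{,ϑ}) / (2χ²) = 0`. -/
def EFE4 (g : KerrLike) (R θ : ℝ) : Prop :=
  dTheta (dR g.lnF) R θ
    - (dR g.lnsF R θ * dTheta g.μ R θ + dTheta g.lnF R θ * dR g.μ R θ)
    + 1 / 2 * dR g.lnsF R θ * dTheta g.lnF R θ
    + (dR g.χ R θ * dTheta g.χ R θ - dR g.ω R θ * dTheta g.ω R θ) / (2 * g.χ R θ ^ 2) = 0

/-- `(√Δ (√Δ F)_{,R})_{,R} - F_{,ϑϑ}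
+ 2F [(ln F)_{,ϑ} (¼ (ln F)_{,ϑ} + μ_{,ϑ}) - ¼ ((ln χ)_{,ϑ})²]
- 2ΔF [(ln √Δ F)_{,R} (¼ (ln √Δ F)_{,R} + μ_{,R}) - ¼ ((ln χ)_{,R})²]
- (F/(2χ²)) [Δ (ω_{,R})² - (ω_{,ϑ})²] = 8π F e^{2μ} (p_R - p_ϑ)`. -/
def EFE5 (g : KerrLike) (s : Fluid) (R θ : ℝ) : Prop :=
  dR (fun r t => √(g.Δ r) * dR g.sF r t) R θ - dTheta (dTheta g.F) R θ
    + 2 * g.F R θ * (dTheta g.lnF R θ * (1 / 4 * dTheta g.lnF R θ + dTheta g.μ R θ)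
        - 1 / 4 * dTheta g.lnχ R θ ^ 2)
    - 2 * g.Δ R * g.F R θ * (dR g.lnsF R θ * (1 / 4 * dR g.lnsF R θ + dR g.μ R θ)
        - 1 / 4 * dR g.lnχ R θ ^ 2)
    - g.F R θ / (2 * g.χ R θ ^ 2) * (g.Δ R * dR g.ω R θ ^ 2 - dTheta g.ω R θ ^ 2)
    = 8 * π * g.F R θ * exp (2 * g.μ R θ) * (s.pR R θ - s.pθ R θ)

/-- The full reduced system holds at every point of `U`. -/
structure SolvesEFEOn (g : KerrLike) (s : Fluid) (U : Set (ℝ × ℝ)) : Prop where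
  efe1 : ∀ x ∈ U, g.EFE1 s x.1 x.2
  efe2 : ∀ x ∈ U, g.EFE2 s x.1 x.2
  efe3 : ∀ x ∈ U, g.EFE3 s x.1 x.2
  efe4 : ∀ x ∈ U, g.EFE4 x.1 x.2
  efe5 : ∀ x ∈ U, g.EFE5 s x.1 x.2

end KerrLike

/-- `Σ = R² + a² cos² ϑ`. -/
def kerrSigma (a R θ : ℝ) : ℝ := R ^ 2 + a ^ 2 * cos θ ^ 2

/-- The Gaussian density `ρ_G(R) = M (4π ℓ₀²)^{-3/2} e^{-R²/(4ℓ₀²)}`. -/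
def rhoG (M ℓ₀ R : ℝ) : ℝ :=
  M / (4 * π * ℓ₀ ^ 2) ^ (3 / 2 : ℝ) * exp (-R ^ 2 / (4 * ℓ₀ ^ 2))

/-- The density `ρ(R, ϑ) = (R⁴/Σ²) ρ_G(R)`. -/
def smearedDensity (M ℓ₀ a R θ : ℝ) : ℝ := R ^ 4 / kerrSigma a R θ ^ 2 * rhoG M ℓ₀ R

/-- The mass function `M(R) = 4π ∫₀^R x² ρ_G(x) dx`. -/
def massFunction (M ℓ₀ R : ℝ) : ℝ := 4 * π * ∫ x in (0 : ℝ)..R, x ^ 2 * rhoG M ℓ₀ x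

/-- `Δ = R² - 2 R M(R) + a²`. -/
def kerrrDelta (M ℓ₀ a R : ℝ) : ℝ := R ^ 2 - 2 * R * massFunction M ℓ₀ R + a ^ 2

/-- The Kerrr line element (the Kerr metric with the mass replaced by the mass function), as
a quadratic form in `v = (dt, dR, dϑ, dφ)`. -/
def kerrrLineElement (M ℓ₀ a R θ : ℝ) (v : Fin 4 → ℝ) : ℝ :=
  (1 - 2 * R * massFunction M ℓ₀ R / kerrSigma a R θ) * v 0 ^ 2
    + 4 * a * R * massFunction M ℓ₀ R / kerrSigma a R θ * sin θ ^ 2 * v 0 * v 3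
    - kerrSigma a R θ / kerrrDelta M ℓ₀ a R * v 1 ^ 2
    - kerrSigma a R θ * v 2 ^ 2
    - sin θ ^ 2 / kerrSigma a R θ
        * ((R ^ 2 + a ^ 2) ^ 2 - a ^ 2 * sin θ ^ 2 * kerrrDelta M ℓ₀ a R) * v 3 ^ 2

end

/-! The contradiction is one of sign, and it already occurs at a single point. Equality of the line
elements fixes all five functions; in particular F = sin ϑ, Δ = Δ_K and e^{2μ} = Σ
(`KerrLike.eq_kerrr_of_lineElement_eq`). In (EFE5) − (EFE1) the second radial derivative and p_ϑ
cancel, leaving an equation for p_R alone, free of Ω (`KerrLike.radial_pressure_eq`). For the Kerrr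
functions its left side is sin ϑ · 2(R² − a² + Δ − RΔ')/Σ (`kerr_radial_pressure_identity`). Since
M' = 4πR²ρ_G, this equals 16π sin ϑ R⁴ρ_G/Σ > 0. The right side is 16π sin ϑ Σ p_R, so the equations
force p_R = +ρ, whereas p_R = −ρ makes that side negative. -/

/-- Here u stands for sin² ϑ, with cos² ϑ already replaced by 1 − u, so no trigonometric relation
remains and clearing denominators leaves a polynomial identity. D and P, playing Δ and Δ', are
independent variables: the mass function does not enter. -/
theorem kerr_radial_pressure_identity_sq {R a D P u S A : ℝ} (hD : D ≠ 0) (hu : u ≠ 0)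
    (hS : S ≠ 0) (hA : A ≠ 0) (hS' : S = R ^ 2 + a ^ 2 * (1 - u))
    (hA' : A = (R ^ 2 + a ^ 2) ^ 2 - a ^ 2 * u * D) :
    2 + 2 * ((1 - u) / u / 4 - a ^ 2 * (1 - u) / S
          - 1 / 4 * ((1 - u) / u * (-2 * a ^ 2 * u / S - 1 + 2 * a ^ 2 * u * D / A) ^ 2))
      - 2 * D * (P / (2 * D) * (1 / 4 * (P / (2 * D)) + R / S)
          - 1 / 4 * (P / (2 * D) + 2 * R / S
            - (4 * R * (R ^ 2 + a ^ 2) - a ^ 2 * u * P) / A) ^ 2)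
      - u * A ^ 2 / (2 * D * S ^ 2)
        * (D * ((a * (2 * R - P) * A - a * (R ^ 2 + a ^ 2 - D)
              * (4 * R * (R ^ 2 + a ^ 2) - a ^ 2 * u * P)) / A ^ 2) ^ 2
          - (1 - u) * u * (2 * a ^ 3 * (R ^ 2 + a ^ 2 - D) * D / A ^ 2) ^ 2)
      = 2 * (R ^ 2 - a ^ 2 + D - R * P) / S := by
  field_simp
  subst hS' hA'
  ring

/-- Sine and cosine enter only through squares once c/s and c·s are factored out of the squared
terms. The leading 2 is −2F_{,ϑϑ}/F for F = sin ϑ. -/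
theorem kerr_radial_pressure_identity {R a D P c s S A : ℝ} (hD : D ≠ 0) (hs : s ≠ 0)
    (hS : S ≠ 0) (hA : A ≠ 0) (hc : c ^ 2 = 1 - s ^ 2) (hS' : S = R ^ 2 + a ^ 2 * c ^ 2)
    (hA' : A = (R ^ 2 + a ^ 2) ^ 2 - a ^ 2 * s ^ 2 * D) :
    2 + 2 * (c / s * (1 / 4 * (c / s) + -(a ^ 2 * c * s) / S)
          - 1 / 4 * (-(2 * a ^ 2 * c * s) / S - c / s + 2 * a ^ 2 * s * c * D / A) ^ 2)
      - 2 * D * (P / (2 * D) * (1 / 4 * (P / (2 * D)) + R / S)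
          - 1 / 4 * (P / (2 * D) + 2 * R / S
            - (4 * R * (R ^ 2 + a ^ 2) - a ^ 2 * s ^ 2 * P) / A) ^ 2)
      - s ^ 2 * A ^ 2 / (2 * D * S ^ 2)
        * (D * ((a * (2 * R - P) * A - a * (R ^ 2 + a ^ 2 - D)
              * (4 * R * (R ^ 2 + a ^ 2) - a ^ 2 * s ^ 2 * P)) / A ^ 2) ^ 2
          - (c * s * (2 * a ^ 3 * (R ^ 2 + a ^ 2 - D) * D / A ^ 2)) ^ 2)
      = 2 * (R ^ 2 - a ^ 2 + D - R * P) / S := by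
  have h := kerr_radial_pressure_identity_sq (P := P) hD (pow_ne_zero 2 hs) hS hA
    (hc ▸ hS') hA'
  rw [← h, ← hc]
  have e1 : -(2 * a ^ 2 * c * s) / S - c / s + 2 * a ^ 2 * s * c * D / A
      = c / s * (-2 * a ^ 2 * s ^ 2 / S - 1 + 2 * a ^ 2 * s ^ 2 * D / A) := by
    field_simp
  have e2 : c / s * (1 / 4 * (c / s) + -(a ^ 2 * c * s) / S)
      = c ^ 2 / s ^ 2 / 4 - a ^ 2 * c ^ 2 / S := by
    field_simp
    ring
  rw [e1, e2, mul_pow (c / s), div_pow c s, mul_pow (c * s), mul_pow c s]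

/-! ### Locality of partial derivatives, and derivatives of M, Δ_K, A and Σ -/

theorem dR_congr_of_isOpen {U : Set (ℝ × ℝ)} (hU : IsOpen U) {f g : ℝ → ℝ → ℝ}
    (h : ∀ x ∈ U, f x.1 x.2 = g x.1 x.2) {x : ℝ × ℝ} (hx : x ∈ U) :
    dR f x.1 x.2 = dR g x.1 x.2 := by
  have hc : ContinuousAt (fun r : ℝ => (r, x.2)) x.1 := by fun_prop
  exact Filter.EventuallyEq.deriv_eq
    ((hc.eventually (hU.mem_nhds hx)).mono fun r hr => h (r, x.2) hr)

theorem dTheta_congr_of_isOpen {U : Set (ℝ × ℝ)} (hU : IsOpen U) {f g : ℝ → ℝ → ℝ}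
    (h : ∀ x ∈ U, f x.1 x.2 = g x.1 x.2) {x : ℝ × ℝ} (hx : x ∈ U) :
    dTheta f x.1 x.2 = dTheta g x.1 x.2 := by
  have hc : ContinuousAt (fun t : ℝ => (x.1, t)) x.2 := by fun_prop
  exact Filter.EventuallyEq.deriv_eq
    ((hc.eventually (hU.mem_nhds hx)).mono fun t ht => h (x.1, t) ht)

theorem rhoG_pos {M ℓ₀ : ℝ} (hM : 0 < M) (hℓ₀ : 0 < ℓ₀) (R : ℝ) : 0 < rhoG M ℓ₀ R := by
  unfold rhoG
  positivity

theorem hasDerivAt_massFunction (M ℓ₀ R : ℝ) :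
    HasDerivAt (massFunction M ℓ₀) (4 * π * (R ^ 2 * rhoG M ℓ₀ R)) R := by
  have hc : Continuous fun x => x ^ 2 * rhoG M ℓ₀ x := by
    unfold rhoG
    fun_prop
  exact (intervalIntegral.integral_hasDerivAt_right (hc.intervalIntegrable _ _)
    hc.stronglyMeasurable.stronglyMeasurableAtFilter hc.continuousAt).const_mul (4 * π)

theorem hasDerivAt_kerrrDelta (M ℓ₀ a R : ℝ) :
    HasDerivAt (kerrrDelta M ℓ₀ a)
      (2 * R - 2 * massFunction M ℓ₀ R - 2 * R * (4 * π * (R ^ 2 * rhoG M ℓ₀ R))) R := by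
  have h := ((hasDerivAt_pow 2 R).sub
    (((hasDerivAt_id R).const_mul 2).mul (hasDerivAt_massFunction M ℓ₀ R))).add_const (a ^ 2)
  refine h.congr_deriv ?_
  simp
  ring

/-- `A = (R² + a²)² - a² sin² ϑ Δ_K`. -/
noncomputable def kerrrA (M ℓ₀ a R θ : ℝ) : ℝ :=
  (R ^ 2 + a ^ 2) ^ 2 - a ^ 2 * sin θ ^ 2 * kerrrDelta M ℓ₀ a R

theorem hasDerivAt_kerrrA_radius (M ℓ₀ a R θ : ℝ) {P : ℝ}
    (hP : HasDerivAt (kerrrDelta M ℓ₀ a) P R) :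
    HasDerivAt (fun r => kerrrA M ℓ₀ a r θ)
      (4 * R * (R ^ 2 + a ^ 2) - a ^ 2 * sin θ ^ 2 * P) R := by
  have h := (((hasDerivAt_pow 2 R).add_const (a ^ 2)).pow 2).sub
    (hP.const_mul (a ^ 2 * sin θ ^ 2))
  refine h.congr_deriv ?_
  simp
  ring

theorem hasDerivAt_kerrrA_angle (M ℓ₀ a R θ : ℝ) :
    HasDerivAt (fun t => kerrrA M ℓ₀ a R t)
      (-(2 * a ^ 2 * sin θ * cos θ * kerrrDelta M ℓ₀ a R)) θ := by
  have h := ((((hasDerivAt_sin θ).pow 2).const_mul (a ^ 2)).mul_const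
    (kerrrDelta M ℓ₀ a R)).const_sub ((R ^ 2 + a ^ 2) ^ 2)
  refine h.congr_deriv ?_
  push_cast
  ring

theorem hasDerivAt_kerrSigma_radius (a R θ : ℝ) :
    HasDerivAt (fun r => kerrSigma a r θ) (2 * R) R := by
  have h := (hasDerivAt_pow 2 R).add_const (a ^ 2 * cos θ ^ 2)
  refine h.congr_deriv ?_
  simp

theorem hasDerivAt_kerrSigma_angle (a R θ : ℝ) :
    HasDerivAt (fun t => kerrSigma a R t) (-(2 * a ^ 2 * cos θ * sin θ)) θ := by
  have h := (((hasDerivAt_cos θ).pow 2).const_mul (a ^ 2)).const_add (R ^ 2)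
  refine h.congr_deriv ?_
  simp
  ring

theorem kerrSigma_pos {a R θ : ℝ} (hR : 0 < R) : 0 < kerrSigma a R θ := by
  unfold kerrSigma
  positivity

/-! ### Reading the five functions off the metric -/

theorem KerrLike.eq_kerrr_of_lineElement_eq {g : KerrLike} {M ℓ₀ a R θ : ℝ}
    (hR : 0 < R) (hθ : 0 < sin θ) (hΔ : 0 < g.Δ R) (hF : 0 < g.F R θ) (hχ : 0 < g.χ R θ)
    (h : ∀ v : Fin 4 → ℝ, g.lineElement R θ v = kerrrLineElement M ℓ₀ a R θ v) :
    exp (2 * g.μ R θ) = kerrSigma a R θ ∧ g.Δ R = kerrrDelta M ℓ₀ a R ∧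
      0 < kerrrA M ℓ₀ a R θ ∧ g.F R θ = sin θ ∧
      g.χ R θ = √(kerrrDelta M ℓ₀ a R) * kerrSigma a R θ / (sin θ * kerrrA M ℓ₀ a R θ) ∧
      g.ω R θ = a * (R ^ 2 + a ^ 2 - kerrrDelta M ℓ₀ a R) / kerrrA M ℓ₀ a R θ := by
  have h0 := h ![1, 0, 0, 0]
  have h1 := h ![0, 1, 0, 0]
  have h2 := h ![0, 0, 1, 0]
  have h3 := h ![0, 0, 0, 1]
  -- The basis vectors give the diagonal coefficients; this sum gives the dt dφ coefficient by
  -- polarization.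
  have h4 := h ![1, 0, 0, 1]
  simp [KerrLike.lineElement, kerrrLineElement] at h0 h1 h2 h3 h4
  have hS : 0 < kerrSigma a R θ := kerrSigma_pos hR
  have hΔ' : g.Δ R = kerrrDelta M ℓ₀ a R := by
    rw [h2] at h1
    simpa [div_eq_mul_inv, hS.ne'] using h1
  have hD : 0 < kerrrDelta M ℓ₀ a R := hΔ' ▸ hΔ
  rw [← kerrrA] at h3 h4
  rw [hΔ'] at h0 h3 h4
  set D := kerrrDelta M ℓ₀ a R with hDdef
  set S := kerrSigma a R θ with hSdef
  set A := kerrrA M ℓ₀ a R θ with hAdef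
  have hm : 2 * R * massFunction M ℓ₀ R = R ^ 2 + a ^ 2 - D := by
    rw [hDdef, kerrrDelta]
    ring
  have hsD : 0 < √D := sqrt_pos.2 hD
  have hA : 0 < A := by
    have : 0 < sin θ ^ 2 / S * A := h3 ▸ by positivity
    exact pos_of_mul_pos_right this (by positivity)
  have hsc : sin θ ^ 2 + cos θ ^ 2 = 1 := sin_sq_add_cos_sq θ
  have hSA : S = R ^ 2 + a ^ 2 * (1 - sin θ ^ 2) := by
    rw [hSdef, kerrSigma, ← cos_sq']
  have hAA : A = (R ^ 2 + a ^ 2) ^ 2 - a ^ 2 * sin θ ^ 2 * D := rfl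
  have hω : g.ω R θ = a * (R ^ 2 + a ^ 2 - D) / A := by
    have e : g.ω R θ * (√D * g.F R θ / g.χ R θ)
        = a * (R ^ 2 + a ^ 2 - D) / S * sin θ ^ 2 := by
      rw [← hm]
      linear_combination (h4 - h0 + h3) / 2
    rw [h3] at e
    field_simp at e ⊢
    linear_combination e
  -- Minus the determinant of the (t, φ) block, which is e^{2β} in the general metric and Δ_K sin² ϑ
  -- in the Kerrr metric; positivity then fixes the root F = sin ϑ.
  have hF2 : (√D * g.F R θ) ^ 2 = D * sin θ ^ 2 := by
    have e : (√D * g.F R θ) ^ 2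
        = (√D * g.F R θ * (g.χ R θ - g.ω R θ ^ 2 / g.χ R θ)) * (√D * g.F R θ / g.χ R θ)
          + g.ω R θ ^ 2 * (√D * g.F R θ / g.χ R θ) ^ 2 := by
      field_simp
      ring
    rw [e, h0, h3, hω, hm]
    field_simp
    rw [hAA, hSA]
    ring
  have hF' : g.F R θ = sin θ := by
    rw [mul_pow, sq_sqrt hD.le] at hF2
    exact (pow_left_inj₀ hF.le hθ.le two_ne_zero).1 (mul_left_cancel₀ hD.ne' hF2)
  refine ⟨h2, hΔ', hA, hF', ?_, hω⟩
  rw [hF'] at h3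
  field_simp at h3 ⊢
  linear_combination -h3

/-! ### Derivatives of ln χ and ω for the Kerrr functions -/

section Derivatives

variable {M ℓ₀ a R θ P : ℝ}

theorem hasDerivAt_log_kerrr_chi_radius (hP : HasDerivAt (kerrrDelta M ℓ₀ a) P R)
    (hD : 0 < kerrrDelta M ℓ₀ a R) (hS : 0 < kerrSigma a R θ) (hA : 0 < kerrrA M ℓ₀ a R θ) :
    HasDerivAt (fun r => 1 / 2 * log (kerrrDelta M ℓ₀ a r) + log (kerrSigma a r θ)
        - log (sin θ) - log (kerrrA M ℓ₀ a r θ))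
      (P / (2 * kerrrDelta M ℓ₀ a R) + 2 * R / kerrSigma a R θ
        - (4 * R * (R ^ 2 + a ^ 2) - a ^ 2 * sin θ ^ 2 * P) / kerrrA M ℓ₀ a R θ) R := by
  have h := ((((hP.log hD.ne').const_mul (1 / 2)).add
    ((hasDerivAt_kerrSigma_radius a R θ).log hS.ne')).sub_const (log (sin θ))).sub
    ((hasDerivAt_kerrrA_radius M ℓ₀ a R θ hP).log hA.ne')
  refine h.congr_deriv ?_
  ring

theorem hasDerivAt_log_kerrr_chi_angle (hs : 0 < sin θ) (hS : 0 < kerrSigma a R θ)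
    (hA : 0 < kerrrA M ℓ₀ a R θ) :
    HasDerivAt (fun t => 1 / 2 * log (kerrrDelta M ℓ₀ a R) + log (kerrSigma a R t)
        - log (sin t) - log (kerrrA M ℓ₀ a R t))
      (-(2 * a ^ 2 * cos θ * sin θ) / kerrSigma a R θ - cos θ / sin θ
        + 2 * a ^ 2 * sin θ * cos θ * kerrrDelta M ℓ₀ a R / kerrrA M ℓ₀ a R θ) θ := by
  have h := ((((hasDerivAt_kerrSigma_angle a R θ).log hS.ne').const_add
    (1 / 2 * log (kerrrDelta M ℓ₀ a R))).sub ((hasDerivAt_sin θ).log hs.ne')).sub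
    ((hasDerivAt_kerrrA_angle M ℓ₀ a R θ).log hA.ne')
  refine h.congr_deriv ?_
  ring

theorem hasDerivAt_kerrr_omega_radius (hP : HasDerivAt (kerrrDelta M ℓ₀ a) P R)
    (hA : 0 < kerrrA M ℓ₀ a R θ) :
    HasDerivAt (fun r => a * (r ^ 2 + a ^ 2 - kerrrDelta M ℓ₀ a r) / kerrrA M ℓ₀ a r θ)
      ((a * (2 * R - P) * kerrrA M ℓ₀ a R θ - a * (R ^ 2 + a ^ 2 - kerrrDelta M ℓ₀ a R)
        * (4 * R * (R ^ 2 + a ^ 2) - a ^ 2 * sin θ ^ 2 * P)) / kerrrA M ℓ₀ a R θ ^ 2) R := by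
  have h := ((((hasDerivAt_pow 2 R).add_const (a ^ 2)).sub hP).const_mul a).div
    (hasDerivAt_kerrrA_radius M ℓ₀ a R θ hP) hA.ne'
  refine h.congr_deriv ?_
  simp

theorem hasDerivAt_kerrr_omega_angle (hA : 0 < kerrrA M ℓ₀ a R θ) :
    HasDerivAt (fun t => a * (R ^ 2 + a ^ 2 - kerrrDelta M ℓ₀ a R) / kerrrA M ℓ₀ a R t)
      (cos θ * sin θ * (2 * a ^ 3 * (R ^ 2 + a ^ 2 - kerrrDelta M ℓ₀ a R)
        * kerrrDelta M ℓ₀ a R / kerrrA M ℓ₀ a R θ ^ 2)) θ := by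
  have h := (hasDerivAt_const θ (a * (R ^ 2 + a ^ 2 - kerrrDelta M ℓ₀ a R))).div
    (hasDerivAt_kerrrA_angle M ℓ₀ a R θ) hA.ne'
  refine h.congr_deriv ?_
  ring

end Derivatives

/-- Subtracting the first from the fifth field equation eliminates the second radial derivative
and the tangential pressure. -/
theorem KerrLike.radial_pressure_eq {g : KerrLike} {s : Fluid} {R θ : ℝ}
    (h1 : g.EFE1 s R θ) (h5 : g.EFE5 s R θ) :
    -2 * dTheta (dTheta g.F) R θ
      + 2 * g.F R θ * (dTheta g.lnF R θ * (1 / 4 * dTheta g.lnF R θ + dTheta g.μ R θ)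
        - 1 / 4 * dTheta g.lnχ R θ ^ 2)
      - 2 * g.Δ R * g.F R θ * (dR g.lnsF R θ * (1 / 4 * dR g.lnsF R θ + dR g.μ R θ)
        - 1 / 4 * dR g.lnχ R θ ^ 2)
      - g.F R θ / (2 * g.χ R θ ^ 2) * (g.Δ R * dR g.ω R θ ^ 2 - dTheta g.ω R θ ^ 2)
      = 16 * π * g.F R θ * exp (2 * g.μ R θ) * s.pR R θ := by
  unfold KerrLike.EFE1 at h1
  unfold KerrLike.EFE5 at h5
  linear_combination h5 - h1

/-! ### The sign contradiction -/

theorem theorem1 (M ℓ₀ a : ℝ) (hM : 0 < M) (hℓ₀ : 0 < ℓ₀)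
    (h_horizon : ∃ R : ℝ, 0 < R ∧ kerrrDelta M ℓ₀ a R = 0)
    (U : Set (ℝ × ℝ)) (hU : IsOpen U) (hU_ne : U.Nonempty)
    (hU_chart : U ⊆ Set.Ioi (0 : ℝ) ×ˢ Set.Ioo (0 : ℝ) Real.pi) :
    ¬ ∃ (g : KerrLike) (s : Fluid),
        g.IsRegularOn U ∧ g.TimelikeFlowOn s U ∧
        (∀ x ∈ U, s.ρ x.1 x.2 = smearedDensity M ℓ₀ a x.1 x.2) ∧
        (∀ x ∈ U, s.pR x.1 x.2 = -s.ρ x.1 x.2) ∧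
        (∀ x ∈ U, ∀ v : Fin 4 → ℝ,
          g.lineElement x.1 x.2 v = kerrrLineElement M ℓ₀ a x.1 x.2 v) ∧
        g.SolvesEFEOn s U := by
  rintro ⟨g, s, hg, -, hρ, hp, hline, hE⟩
  have hsin : ∀ x ∈ U, 0 < sin x.2 := fun x hx => sin_pos_of_mem_Ioo (hU_chart hx).2
  have hR : ∀ x ∈ U, 0 < x.1 := fun x hx => (hU_chart hx).1
  have hS : ∀ x ∈ U, 0 < kerrSigma a x.1 x.2 := fun x hx => kerrSigma_pos (hR x hx)
  have key := fun x hx => KerrLike.eq_kerrr_of_lineElement_eq (hR x hx) (hsin x hx)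
    (hg.pos_Δ x hx) (hg.pos_F x hx) (hg.pos_χ x hx) (hline x hx)
  have hD : ∀ x ∈ U, 0 < kerrrDelta M ℓ₀ a x.1 := fun x hx =>
    (key x hx).2.1 ▸ hg.pos_Δ x hx
  have hA : ∀ x ∈ U, 0 < kerrrA M ℓ₀ a x.1 x.2 := fun x hx => (key x hx).2.2.1
  have hF : ∀ x ∈ U, g.F x.1 x.2 = sin x.2 := fun x hx => (key x hx).2.2.2.1
  have hω : ∀ x ∈ U, g.ω x.1 x.2
      = a * (x.1 ^ 2 + a ^ 2 - kerrrDelta M ℓ₀ a x.1) / kerrrA M ℓ₀ a x.1 x.2 :=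
    fun x hx => (key x hx).2.2.2.2.2
  have hlnF : ∀ x ∈ U, g.lnF x.1 x.2 = log (sin x.2) := fun x hx => by
    rw [KerrLike.lnF, hF x hx]
  have hlnsF : ∀ x ∈ U,
      g.lnsF x.1 x.2 = 1 / 2 * log (kerrrDelta M ℓ₀ a x.1) + log (sin x.2) := fun x hx => by
    rw [KerrLike.lnsF, KerrLike.sF, hF x hx, (key x hx).2.1,
      log_mul (sqrt_pos.2 (hD x hx)).ne' (hsin x hx).ne', log_sqrt (hD x hx).le]
    ring
  have hlnχ : ∀ x ∈ U, g.lnχ x.1 x.2 = 1 / 2 * log (kerrrDelta M ℓ₀ a x.1)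
      + log (kerrSigma a x.1 x.2) - log (sin x.2) - log (kerrrA M ℓ₀ a x.1 x.2) :=
    fun x hx => by
      have h1 := (sqrt_pos.2 (hD x hx)).ne'
      have h2 := (hS x hx).ne'
      have h3 := (hsin x hx).ne'
      have h4 := (hA x hx).ne'
      rw [KerrLike.lnχ, (key x hx).2.2.2.2.1, log_div (mul_ne_zero h1 h2) (mul_ne_zero h3 h4),
        log_mul h1 h2, log_mul h3 h4, log_sqrt (hD x hx).le]
      ring
  have hμ : ∀ x ∈ U, g.μ x.1 x.2 = 1 / 2 * log (kerrSigma a x.1 x.2) := fun x hx => by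
    rw [← (key x hx).1, log_exp]
    ring
  obtain ⟨x, hx⟩ := hU_ne
  have hP := hasDerivAt_kerrrDelta M ℓ₀ a x.1
  set P := 2 * x.1 - 2 * massFunction M ℓ₀ x.1
    - 2 * x.1 * (4 * π * (x.1 ^ 2 * rhoG M ℓ₀ x.1)) with hPdef
  -- Needed on all of U, not only at x, because it is differentiated once more.
  have dF : ∀ y ∈ U, dTheta g.F y.1 y.2 = cos y.2 := fun y hy =>
    (dTheta_congr_of_isOpen (g := fun _ t => sin t) hU hF hy).trans (hasDerivAt_sin _).deriv
  have ddF : dTheta (dTheta g.F) x.1 x.2 = -sin x.2 :=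
    (dTheta_congr_of_isOpen (g := fun _ t => cos t) hU dF hx).trans (hasDerivAt_cos _).deriv
  have dlnF : dTheta g.lnF x.1 x.2 = cos x.2 / sin x.2 :=
    (dTheta_congr_of_isOpen (g := fun _ t => log (sin t)) hU hlnF hx).trans
      ((hasDerivAt_sin _).log (hsin x hx).ne').deriv
  have dlnsF : dR g.lnsF x.1 x.2 = P / (2 * kerrrDelta M ℓ₀ a x.1) := by
    refine (dR_congr_of_isOpen (g := fun r t => 1 / 2 * log (kerrrDelta M ℓ₀ a r)
      + log (sin t)) hU hlnsF hx).trans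
      ((((hP.log (hD x hx).ne').const_mul (1 / 2)).add_const _).deriv.trans ?_)
    ring
  have dμθ : dTheta g.μ x.1 x.2 = -(a ^ 2 * cos x.2 * sin x.2) / kerrSigma a x.1 x.2 := by
    refine (dTheta_congr_of_isOpen (g := fun r t => 1 / 2 * log (kerrSigma a r t)) hU hμ
      hx).trans ((((hasDerivAt_kerrSigma_angle a x.1 x.2).log (hS x hx).ne').const_mul
        (1 / 2)).deriv.trans ?_)
    ring
  have dμR : dR g.μ x.1 x.2 = x.1 / kerrSigma a x.1 x.2 := by
    refine (dR_congr_of_isOpen (g := fun r t => 1 / 2 * log (kerrSigma a r t)) hU hμ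
      hx).trans ((((hasDerivAt_kerrSigma_radius a x.1 x.2).log (hS x hx).ne').const_mul
        (1 / 2)).deriv.trans ?_)
    ring
  have dχR := (dR_congr_of_isOpen (g := fun r t => 1 / 2 * log (kerrrDelta M ℓ₀ a r)
    + log (kerrSigma a r t) - log (sin t) - log (kerrrA M ℓ₀ a r t)) hU hlnχ hx).trans
      (hasDerivAt_log_kerrr_chi_radius hP (hD x hx) (hS x hx) (hA x hx)).deriv
  have dχθ := (dTheta_congr_of_isOpen (g := fun r t => 1 / 2 * log (kerrrDelta M ℓ₀ a r)
    + log (kerrSigma a r t) - log (sin t) - log (kerrrA M ℓ₀ a r t)) hU hlnχ hx).trans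
      (hasDerivAt_log_kerrr_chi_angle (hsin x hx) (hS x hx) (hA x hx)).deriv
  have dωR := (dR_congr_of_isOpen (g := fun r t => a * (r ^ 2 + a ^ 2 - kerrrDelta M ℓ₀ a r)
    / kerrrA M ℓ₀ a r t) hU hω hx).trans (hasDerivAt_kerrr_omega_radius hP (hA x hx)).deriv
  have dωθ := (dTheta_congr_of_isOpen
    (g := fun r t => a * (r ^ 2 + a ^ 2 - kerrrDelta M ℓ₀ a r) / kerrrA M ℓ₀ a r t)
    hU hω hx).trans (hasDerivAt_kerrr_omega_angle (hA x hx)).deriv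
  have hχ2 : g.χ x.1 x.2 ^ 2 = kerrrDelta M ℓ₀ a x.1 * kerrSigma a x.1 x.2 ^ 2
      / (sin x.2 ^ 2 * kerrrA M ℓ₀ a x.1 x.2 ^ 2) := by
    rw [(key x hx).2.2.2.2.1, div_pow, mul_pow, mul_pow, sq_sqrt (hD x hx).le]
  have hEq := KerrLike.radial_pressure_eq (hE.efe1 x hx) (hE.efe5 x hx)
  have hId := kerr_radial_pressure_identity (P := P) (hD x hx).ne' (hsin x hx).ne' (hS x hx).ne'
    (hA x hx).ne' (cos_sq' x.2) rfl rfl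
  have hcoef : 1 / (2 * (kerrrDelta M ℓ₀ a x.1 * kerrSigma a x.1 x.2 ^ 2
      / (sin x.2 ^ 2 * kerrrA M ℓ₀ a x.1 x.2 ^ 2))) = sin x.2 ^ 2 * kerrrA M ℓ₀ a x.1 x.2 ^ 2
        / (2 * kerrrDelta M ℓ₀ a x.1 * kerrSigma a x.1 x.2 ^ 2) := by
    rw [← mul_div_assoc, one_div_div, mul_assoc 2]
  -- The R², a² and M(R) terms cancel; only the M'(R) contribution survives.
  have hmass : x.1 ^ 2 - a ^ 2 + kerrrDelta M ℓ₀ a x.1 - x.1 * P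
      = 8 * π * x.1 ^ 4 * rhoG M ℓ₀ x.1 := by
    rw [hPdef, kerrrDelta]
    ring
  rw [ddF, dlnF, dlnsF, dμθ, dμR, dχR, dχθ, dωR, dωθ, hχ2, (key x hx).1, (key x hx).2.1,
    hF x hx, hp x hx, hρ x hx, div_eq_mul_one_div (sin x.2), hcoef] at hEq
  rw [hmass] at hId
  have hpos : 0 < sin x.2 * (2 * (8 * π * x.1 ^ 4 * rhoG M ℓ₀ x.1) / kerrSigma a x.1 x.2) := by
    have := hsin x hx
    have := hS x hx
    have := hR x hx
    have := rhoG_pos hM hℓ₀ x.1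
    positivity
  have hneg : 0 ≤ 16 * π * sin x.2 * kerrSigma a x.1 x.2 * smearedDensity M ℓ₀ a x.1 x.2 := by
    have := hsin x hx
    have := hS x hx
    have := hR x hx
    have := rhoG_pos hM hℓ₀ x.1
    unfold smearedDensity
    positivity
  -- `hEq` now equates the positive quantity in `hpos` with minus the nonnegative one in `hneg`.
  rw [← hId] at hpos
  linarith
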